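/- Let $m\ge 0$ and let $\mathcal K$ be a simplicial complex on the vertex set $[m]=\{1,\dots,m\}$: a collection of subsets of $[m]$ (the simplices) that is closed under passing to subsets and contains $\varnothing$ and every one-element set $\{i\}$. For $I\subset[m]$ let $D_I^{\mathbb C}=\{z\in\mathbb C^m : z_i=z_j \text{ for all } i,j\in I\}$, and let $$D_{\mathbb C}(\mathcal K)=\mathbb C^m\setminus\bigcup_{I\notin\mathcal K}D_I^{\mathbb C}$$ be the complement of the complex diagonal arrangement of $\mathcal K$. For $n\ge 0$ let $\mathrm{Perm}^{n-1}=\mathrm{conv}\{(\sigma(1),\dots,\sigma(n)) : \sigma\in S_n\}\subset\mathbb R^n$ be the permutohedron. For an ordered partition $(U_1|\cdots|U_p)$ of $[n]$ into nonempty parts, let $F(U_1|\cdots|U_p)$ be the face of $\mathrm{Perm}^{n-1}$ on which the functionals $x\mapsto\sum_i a_ix_i$ attain their minimum over $\mathrm{Perm}^{n-1}$, where $a\in\mathbb R^n$ is constant on every part and takes a strictly larger value on $U_j$ than on $U_k$ whenever $j<k$ (all such $a$ give the same face). For $n=2m$ write $i'=m+i$ for $1\le i\le m$ and $I'=\{i'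 : i\in I\}$ for $I\subset[m]$, and put $$\mathrm{Perm}_{\mathbb C}(\mathcal K)=\mathrm{Perm}^{2m-1}\setminus\bigcup_{I\notin\mathcal K}\ \bigcup_{\substack{(U_1|\cdots|U_p)\\ \exists\, j,k:\ I\subset U_j,\ I'\subset U_k}}\mathrm{relint}\,F(U_1|\cdots|U_p),$$ where $j=k$ is allowed. Theorem. $\mathrm{Perm}_{\mathbb C}(\mathcal K)$ is a subcomplex of faces of $\mathrm{Perm}^{2m-1}$: it is the union of the closed faces $F(U_1|\cdots|U_p)$ over all ordered partitions of $[2m]$ for which there is no $I\notin\mathcal K$ such that $I$ is contained in some part and $I'$ is contained in some part. Moreover, there is a homotopy equivalence $$D_{\mathbb C}(\mathcal K)\simeq\mathrm{Perm}_{\mathbb C}(\mathcal K).$$ -/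

import Mathlib

open scoped ContinuousMap

/-- The (possibly empty) finite set `I` of vertices is a simplex of `K`. Mathlib lists only the
nonempty simplices in `K.faces`; the empty set is always a simplex here. -/
def IsSimplex {m : ℕ} (K : AbstractSimplicialComplex (Fin m)) (I : Finset (Fin m)) : Prop :=
  I = ∅ ∨ I ∈ K.faces

/-- The complex diagonal subspace `D_I` of `ℂ^m`: all coordinates `z i`, `i ∈ I`, coincide. -/
def complexDiagonal {m : ℕ} (I : Finset (Fin m)) : Submodule ℂ (Fin m → ℂ) where
  carrier := {z | ∀ i ∈ I, ∀ j ∈ I, z i = z j}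
  add_mem' := by
    intro z w hz hw i hi j hj
    simp only [Pi.add_apply, hz i hi j hj, hw i hi j hj]
  zero_mem' := by
    intro i _ j _
    rfl
  smul_mem' := by
    intro c z hz i hi j hj
    simp only [Pi.smul_apply, hz i hi j hj]

/-- The complement `D_ℂ(K)` in `ℂ^m` of the arrangement of the diagonal subspaces `D_I`, where `I`
runs over the subsets that are not simplices of `K`. -/
def complexDiagonalComplement {m : ℕ} (K : AbstractSimplicialComplex (Fin m)) :
    Set (Fin m → ℂ) :=
  Set.univ \ ⋃ (I : Finset (Fin m)) (_ : ¬ IsSimplex K I), (complexDiagonal I : Set (Fin m → ℂ))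

/-- The permutohedron `Perm^{n-1}` in `ℝ^n`: the convex hull of the points `(σ(1), …, σ(n))` for the
permutations `σ` of `{1, …, n}`. The index set is `Fin n = {0, …, n-1}`, whence the shift by one. -/
def permutohedron (n : ℕ) : Set (Fin n → ℝ) :=
  convexHull ℝ {v | ∃ σ : Equiv.Perm (Fin n), ∀ i, v i = ((σ i : ℕ) : ℝ) + 1}

/-- An ordered partition `(U_1 | ⋯ | U_p)` of `{1, …, n}` into nonempty parts. -/
structure OrderedPartition (n : ℕ) where
  /-- the number of parts -/
  length : ℕ
  /-- the parts, in order -/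
  part : Fin length → Finset (Fin n)
  nonempty : ∀ j, (part j).Nonempty
  disjoint : ∀ j k, j ≠ k → Disjoint (part j) (part k)
  cover : ∀ i, ∃ j, i ∈ part j

/-- The covector `a` orders the coordinates according to `U`: it is constant on every part, and its
values strictly decrease from each part to the later ones. -/
def OrderedPartition.IsCovector {n : ℕ} (U : OrderedPartition n) (a : Fin n → ℝ) : Prop :=
  (∀ j, ∀ i ∈ U.part j, ∀ i' ∈ U.part j, a i = a i') ∧
    ∀ j k, j < k → ∀ i ∈ U.part j, ∀ i' ∈ U.part k, a i' < a i

/-- The closed face `F(U_1 | ⋯ | U_p)` of the permutohedron: the points at which the linear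
functionals `⟨a, ·⟩` attain their minimum on the permutohedron, for the covectors `a` of the
ordered partition. (All covectors of an ordered partition single out the same face.) -/
def OrderedPartition.face {n : ℕ} (U : OrderedPartition n) : Set (Fin n → ℝ) :=
  {x | x ∈ permutohedron n ∧
    ∀ a, U.IsCovector a → ∀ y ∈ permutohedron n, ∑ i, a i * x i ≤ ∑ i, a i * y i}

/-- The ordered partition `U` of `{1, …, m, 1', …, m'}` is to be removed because of `I`: the set
`I ⊆ {1, …, m}` lies in some part and its primed copy `I'` lies in some (possibly the same) part.
The index `i` is `Fin.castAdd m i`, and `i' = m + i` is `Fin.natAdd m i`. -/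
def OrderedPartition.Absorbs {m : ℕ} (U : OrderedPartition (m + m)) (I : Finset (Fin m)) : Prop :=
  ∃ j k, (∀ i ∈ I, Fin.castAdd m i ∈ U.part j) ∧ (∀ i ∈ I, Fin.natAdd m i ∈ U.part k)

/-- The complex `Perm_ℂ(K)`: the permutohedron `Perm^{2m-1}` without the relative interiors of the
faces `F(U_1 | ⋯ | U_p)` for which there is a non-simplex `I` of `K` with `I` contained in some part
and `I'` contained in some part. -/
def complexPermutohedralComplex {m : ℕ} (K : AbstractSimplicialComplex (Fin m)) :
    Set (Fin (m + m) → ℝ) :=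
  permutohedron (m + m) \
    ⋃ (I : Finset (Fin m)) (_ : ¬ IsSimplex K I)
      (U : OrderedPartition (m + m)) (_ : U.Absorbs I), intrinsicInterior ℝ U.face

/-! The permutohedron is cut out by `∑ i ∈ S, x i ≥ triangular #S` and a fixed total. The sets `S`
tight at `x` form a chain, and the successive differences of the chain give the ordered partition
whose face has `x` in its relative interior. So `x` is removed exactly when, for some nonsimplex
`I`, no tight set at `x` separates two elements of `I` or two elements of `I'`
(`mem_complexPermutohedralComplex_iff`). Extra tight sets can only help `x` survive, which gives the
union of closed faces.

For the homotopy equivalence, view `ℂ^m` as `ℝ^(2m)`. A tight set forces a coordinate gap of at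
least one, so the permutohedral complex sits inside the diagonal complement. In the other direction,
`spread t` maps into the permutohedron, seen as a zonotope. Coordinates unseparated in the image
differ by at most `2m / t` in the source, so a large `t`, depending continuously on `z`, avoids the
removed faces. Straight segments join both composites to the identity: `spread` preserves the strict
order of coordinates, so no new coincidences arise, and for `t ≥ 1` it keeps every tight set of a
point of the permutohedron tight. -/

open Finset

/-! ### Triangular numbers and summation by layers -/

/-- The `k`-th triangular number `1 + 2 + ⋯ + k`, as a real number. -/
noncomputable def triangular (k : ℕ) : ℝ := (k : ℝ) * (k + 1) / 2

lemma triangular_succ (k : ℕ) : triangular (k + 1) = triangular k + (k + 1) := by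
  simp only [triangular]; push_cast; ring

lemma sum_range_add_one_eq_triangular (k : ℕ) :
    ∑ i ∈ range k, ((i : ℝ) + 1) = triangular k := by
  induction k with
  | zero => simp [triangular]
  | succ k ih => rw [sum_range_succ, ih, triangular_succ]

lemma triangular_card_le_sum (T : Finset ℕ) : triangular #T ≤ ∑ i ∈ T, ((i : ℝ) + 1) := by
  induction T using Finset.induction_on_max with
  | empty => simp [triangular]
  | insert a s ha ih =>
    have hs : a ∉ s := fun h => lt_irrefl _ (ha a h)
    rw [sum_insert hs, card_insert_of_notMem hs, triangular_succ]
    have : #s ≤ a := by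
      simpa using card_le_card (fun x hx => mem_range.2 (ha x hx) : s ⊆ range a)
    have : (#s : ℝ) ≤ a := by exact_mod_cast this
    linarith

lemma eq_range_card_of_lower (T : Finset ℕ) (hT : ∀ a ∈ T, ∀ b, b < a → b ∈ T) :
    T = range #T := by
  refine eq_of_subset_of_card_le (fun k hk => ?_) (by simp)
  have : range (k + 1) ⊆ T := fun b hb => by
    rcases (Nat.lt_succ_iff.1 (mem_range.1 hb)).lt_or_eq with h | h
    · exact hT k hk b h
    · exact h ▸ hk
  have := card_le_card this
  simp at this ⊢
  omega

/-- Summation by layers: if `d` has nonnegative sum over every superlevel set of `a ≥ 0`, then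
`∑ a i * d i` is nonnegative. -/
lemma sum_mul_nonneg_of_superlevel_nonneg {ι : Type*} [Fintype ι] (d : ι → ℝ) :
    ∀ (N : ℕ) (a : ι → ℝ), #{i | 0 < a i} ≤ N → (∀ i, 0 ≤ a i) →
      (∀ c, 0 ≤ c → 0 ≤ ∑ i with c < a i, d i) → 0 ≤ ∑ i, a i * d i := by
  intro N
  induction N with
  | zero =>
    intro a hN ha _
    have h0 : ∀ i, a i = 0 := fun i => by
      have : i ∉ ({i | 0 < a i} : Finset ι) := by
        rw [card_eq_zero.1 (Nat.le_zero.1 hN)]; simp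
      simp at this
      exact le_antisymm this (ha i)
    simp [h0]
  | succ N ih =>
    intro a hN ha hd
    rcases ({i | 0 < a i} : Finset ι).eq_empty_or_nonempty with h | h
    · exact ih a (by simp [h]) ha hd
    obtain ⟨i₀, hi₀, hmin⟩ := exists_min_image _ a h
    simp only [mem_filter, mem_univ, true_and] at hi₀ hmin
    -- Peel off the lowest layer: subtracting the least positive value shrinks the support, and the
    -- superlevel sets of `b` are those of `a` at a shifted level.
    set b : ι → ℝ := fun i => if 0 < a i then a i - a i₀ else 0 with hb
    have hba : ∀ c, 0 ≤ c → ∀ i, c < b i ↔ c + a i₀ < a i := by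
      intro c hc i
      by_cases hi : 0 < a i
      · simp only [hb, hi, if_true]; constructor <;> intro <;> linarith
      · simp only [hb, hi, if_false]; constructor <;> intro <;> linarith
    have hb0 : ∀ i, 0 ≤ b i := by
      intro i
      by_cases hi : 0 < a i
      · simp only [hb, hi, if_true]; linarith [hmin i hi]
      · simp [hb, hi]
    have hcard : #{i | 0 < b i} < #{i | 0 < a i} := by
      refine card_lt_card ((ssubset_iff_of_subset ?_).2 ⟨i₀, by simpa using hi₀, ?_⟩)
      · intro i; simp only [mem_filter, mem_univ, true_and]
        intro hi; have := (hba 0 le_rfl i).1 hi; linarith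
      · simp [hb]
    have hrec := ih b (by omega) hb0 (fun c hc => by
      simp only [hba c hc]; exact hd _ (by linarith))
    have hsum : ∑ i, a i * d i = ∑ i, b i * d i + a i₀ * ∑ i with 0 < a i, d i := by
      rw [mul_sum, sum_filter, ← sum_add_distrib]
      refine sum_congr rfl fun i _ => ?_
      by_cases hi : 0 < a i
      · simp only [hb, hi, if_true]; ring
      · have : a i = 0 := le_antisymm (not_lt.1 hi) (ha i)
        simp [hb, this]
    rw [hsum]
    exact add_nonneg hrec (mul_nonneg hi₀.le (hd 0 le_rfl))

lemma sum_mul_le_sum_mul_of_superlevel {ι : Type*} [Fintype ι] (a x y : ι → ℝ)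
    (htot : ∑ i, x i = ∑ i, y i)
    (h : ∀ c, ∑ i with c < a i, x i ≤ ∑ i with c < a i, y i) :
    ∑ i, a i * x i ≤ ∑ i, a i * y i := by
  obtain ⟨M, hM⟩ := (Set.finite_range a).bddBelow
  have key := sum_mul_nonneg_of_superlevel_nonneg (fun i => y i - x i) _ (fun i => a i - M) le_rfl
    (fun i => sub_nonneg.2 (hM ⟨i, rfl⟩)) (fun c _ => by
      have := h (c + M)
      simp only [lt_sub_iff_add_lt, sum_sub_distrib]
      linarith)
  have : ∑ i, (a i - M) * (y i - x i)
      = ∑ i, a i * y i - ∑ i, a i * x i - M * (∑ i, y i - ∑ i, x i) := by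
    rw [← sum_sub_distrib, ← sum_sub_distrib, mul_sum, ← sum_sub_distrib]
    exact sum_congr rfl fun i _ => by ring
  rw [this, htot] at key
  linarith

/-! ### Inequalities and tight sets of the permutohedron -/

section Permutohedron

variable {n : ℕ}

/-- The inequality `∑ i ∈ S, x i ≥ 1 + ⋯ + |S|` of the permutohedron is an equality at `x`. -/
def IsTight (x : Fin n → ℝ) (S : Finset (Fin n)) : Prop := ∑ i ∈ S, x i = triangular #S

lemma isTight_empty (x : Fin n → ℝ) : IsTight x ∅ := by simp [IsTight, triangular]

lemma convex_permutohedron : Convex ℝ (permutohedron n) := convex_convexHull ℝ _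

lemma isClosed_permutohedron : IsClosed (permutohedron n) := by
  refine (Set.Finite.subset (Set.finite_range
    (fun (σ : Equiv.Perm (Fin n)) (i : Fin n) => ((σ i : ℕ) : ℝ) + 1)) ?_).isClosed_convexHull ℝ
  rintro v ⟨σ, hσ⟩
  exact ⟨σ, (funext hσ).symm⟩

lemma vertex_mem_permutohedron (σ : Equiv.Perm (Fin n)) :
    (fun i => ((σ i : ℕ) : ℝ) + 1) ∈ permutohedron n :=
  subset_convexHull ℝ _ ⟨σ, fun _ => rfl⟩

lemma permutohedron_sum_ge_and_sum_eq {x : Fin n → ℝ} (hx : x ∈ permutohedron n) :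
    (∀ S : Finset (Fin n), triangular #S ≤ ∑ i ∈ S, x i) ∧ ∑ i, x i = triangular n := by
  have hconv : Convex ℝ {x : Fin n → ℝ |
      (∀ S : Finset (Fin n), triangular #S ≤ ∑ i ∈ S, x i) ∧ ∑ i, x i = triangular n} := by
    intro x hx y hy a b ha hb hab
    have hs : ∀ S : Finset (Fin n),
        ∑ i ∈ S, (a • x + b • y) i = a * ∑ i ∈ S, x i + b * ∑ i ∈ S, y i := fun S => by
      simp [sum_add_distrib, mul_sum]
    refine ⟨fun S => ?_, ?_⟩
    · rw [hs]
      calc triangular #S = a * triangular #S + b * triangular #S := by rw [← add_mul, hab, one_mul]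
        _ ≤ _ := add_le_add (mul_le_mul_of_nonneg_left (hx.1 S) ha)
            (mul_le_mul_of_nonneg_left (hy.1 S) hb)
    · rw [hs, hx.2, hy.2, ← add_mul, hab, one_mul]
  refine convexHull_min ?_ hconv hx
  rintro v ⟨σ, hσ⟩
  refine ⟨fun S => ?_, ?_⟩
  · have h := triangular_card_le_sum (S.map (σ.toEmbedding.trans Fin.valEmbedding))
    simpa [hσ] using h
  · rw [← sum_range_add_one_eq_triangular, ← Fin.sum_univ_eq_sum_range (fun i => (i : ℝ) + 1) n]
    simp only [hσ]
    exact Equiv.sum_comp σ (fun i => ((i : ℕ) : ℝ) + 1)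

lemma triangular_le_sum {x : Fin n → ℝ} (hx : x ∈ permutohedron n) (S : Finset (Fin n)) :
    triangular #S ≤ ∑ i ∈ S, x i := (permutohedron_sum_ge_and_sum_eq hx).1 S

lemma isTight_univ {x : Fin n → ℝ} (hx : x ∈ permutohedron n) : IsTight x univ := by
  simpa [IsTight] using (permutohedron_sum_ge_and_sum_eq hx).2

/-- The greedy vertex gives the values `1, 2, …` to the indices in order of decreasing `a`, so each
superlevel set receives an initial segment of values. By summation by layers this vertex minimises
the functional `a`. -/
lemma exists_mem_permutohedron_isTight_superlevel (a : Fin n → ℝ) :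
    ∃ v ∈ permutohedron n, ∀ c, IsTight v ({i | c < a i} : Finset (Fin n)) := by
  set σ := Tuple.sort (fun i => - a i) with hσ
  have hmono : Monotone ((fun i => - a i) ∘ σ) := Tuple.monotone_sort _
  refine ⟨_, vertex_mem_permutohedron σ⁻¹, fun c => ?_⟩
  set T : Finset ℕ :=
    ({i | c < a i} : Finset (Fin n)).map (σ⁻¹.toEmbedding.trans Fin.valEmbedding) with hT
  have hcard : #T = #({i | c < a i} : Finset (Fin n)) := card_map _
  have hsum : ∑ i ∈ T, ((i : ℝ) + 1)
      = ∑ i ∈ ({i | c < a i} : Finset (Fin n)), (((σ⁻¹ i : Fin n) : ℕ) + 1 : ℝ) := by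
    rw [hT, sum_map]; rfl
  have hlow : ∀ k ∈ T, ∀ l, l < k → l ∈ T := by
    intro k hk l hl
    simp only [hT, mem_map, mem_filter, mem_univ, true_and] at hk ⊢
    obtain ⟨i, hi, rfl⟩ := hk
    have hl' : l < ((σ⁻¹ i : Fin n) : ℕ) := hl
    refine ⟨σ ⟨l, hl'.trans (σ⁻¹ i).2⟩, ?_, ?_⟩
    · have := hmono (show (⟨l, hl'.trans (σ⁻¹ i).2⟩ : Fin n) ≤ σ⁻¹ i from hl'.le)
      have e : σ (σ⁻¹ i) = i := σ.apply_symm_apply i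
      simp only [Function.comp_apply, e] at this
      linarith
    · simp
  rw [IsTight, ← hsum, ← hcard]
  conv_lhs => rw [eq_range_card_of_lower T hlow]
  exact sum_range_add_one_eq_triangular _

/-- The description of the permutohedron by inequalities. -/
lemma mem_permutohedron_of_triangular_le {x : Fin n → ℝ}
    (h : ∀ S : Finset (Fin n), triangular #S ≤ ∑ i ∈ S, x i) (htot : ∑ i, x i = triangular n) :
    x ∈ permutohedron n := by
  by_contra hx
  obtain ⟨f, u, hfx, hfu⟩ :=
    geometric_hahn_banach_point_closed convex_permutohedron isClosed_permutohedron hx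
  have hf : ∀ y : Fin n → ℝ, f y = ∑ i, f (Pi.single i 1) * y i := fun y => by
    conv_lhs => rw [← Finset.univ_sum_single y, map_sum]
    refine sum_congr rfl fun i _ => ?_
    have : (Pi.single i (y i) : Fin n → ℝ) = y i • Pi.single i 1 := by
      rw [← Pi.single_smul, smul_eq_mul, mul_one]
    rw [this, map_smul, smul_eq_mul, mul_comm]
  obtain ⟨v, hv, hvt⟩ := exists_mem_permutohedron_isTight_superlevel
    (fun i => f (Pi.single i 1))
  have := sum_mul_le_sum_mul_of_superlevel (fun i => f (Pi.single i 1)) v x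
    (by rw [htot, (permutohedron_sum_ge_and_sum_eq hv).2])
    (fun c => (hvt c).le.trans (h _))
  rw [← hf, ← hf] at this
  linarith [hfu v hv]

/-- Removing `i` from `S` gives `x i ≤ #S`; adding `j` gives `x j ≥ #S + 1`. -/
lemma IsTight.add_one_le {x : Fin n → ℝ} (hx : x ∈ permutohedron n) {S : Finset (Fin n)}
    (hS : IsTight x S) {i j : Fin n} (hi : i ∈ S) (hj : j ∉ S) : x i + 1 ≤ x j := by
  have h1 := triangular_le_sum hx (S.erase i)
  have h2 := triangular_le_sum hx (insert j S)
  have h3 := add_sum_erase S x hi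
  have h4 : #S = #(S.erase i) + 1 := (card_erase_add_one hi).symm
  rw [sum_insert hj, card_insert_of_notMem hj, triangular_succ] at h2
  unfold IsTight at hS
  have h5 := triangular_succ #(S.erase i)
  rw [← h4] at h5
  have h6 : (#S : ℝ) = #(S.erase i) + 1 := by exact_mod_cast h4
  linarith

lemma IsTight.subset_or_subset {x : Fin n → ℝ} (hx : x ∈ permutohedron n) {S T : Finset (Fin n)}
    (hS : IsTight x S) (hT : IsTight x T) : S ⊆ T ∨ T ⊆ S := by
  by_contra! h
  obtain ⟨i, hi, hi'⟩ := not_subset.1 h.1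
  obtain ⟨j, hj, hj'⟩ := not_subset.1 h.2
  linarith [hS.add_one_le hx hi hj', hT.add_one_le hx hj hi']

lemma IsTight.combo {x y : Fin n → ℝ} {S : Finset (Fin n)} (hx : IsTight x S) (hy : IsTight y S)
    {a b : ℝ} (hab : a + b = 1) : IsTight (a • x + b • y) S := by
  have : ∑ i ∈ S, (a • x + b • y) i = a * ∑ i ∈ S, x i + b * ∑ i ∈ S, y i := by
    simp [sum_add_distrib, mul_sum]
  rw [IsTight, this, hx, hy, ← add_mul, hab, one_mul]

/-! ### The map to the permutohedron as a zonotope -/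

/-- The truncation of a real number to the interval `[-1, 1]`. -/
noncomputable def clamp (u : ℝ) : ℝ := max (-1) (min 1 u)

lemma clamp_neg (u : ℝ) : clamp (-u) = - clamp u := by
  unfold clamp
  rcases le_total u (-1) with h | h <;> rcases le_total u 1 with h' | h' <;>
    simp [min_def, max_def] <;> split_ifs <;> linarith

lemma neg_one_le_clamp (u : ℝ) : -1 ≤ clamp u := le_max_left _ _

lemma clamp_mono : Monotone clamp := fun _ _ h => max_le_max le_rfl (min_le_min le_rfl h)

lemma clamp_zero : clamp 0 = 0 := by norm_num [clamp]

lemma clamp_pos {u : ℝ} (hu : 0 < u) : 0 < clamp u := by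
  unfold clamp; exact lt_max_of_lt_right (lt_min one_pos hu)

lemma clamp_eq_neg_one_iff (u : ℝ) : clamp u = -1 ↔ u ≤ -1 := by
  unfold clamp
  constructor
  · intro h
    have : min 1 u ≤ -1 := h ▸ le_max_right _ _
    rcases min_le_iff.1 this with h | h
    · norm_num at h
    · exact h
  · intro h
    exact max_eq_left ((min_le_right _ _).trans h)

lemma continuous_clamp : Continuous clamp :=
  continuous_const.max (continuous_const.min continuous_id)

/-- The point of the permutohedron (as a zonotope) obtained by pushing the edge directions
`e i - e j` according to the truncated differences `t * (w i - w j)`. -/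
noncomputable def spread (t : ℝ) (w : Fin n → ℝ) : Fin n → ℝ :=
  fun i => ((n : ℝ) + 1) / 2 + (∑ j, clamp (t * (w i - w j))) / 2

/-- Pairs inside `S` cancel because `clamp` is odd. The `+ 1` absorbs the rest of the constant term
and displays the excess over the bound as a sum of nonnegative terms, so tightness means that each
of them vanishes. -/
lemma sum_spread (t : ℝ) (w : Fin n → ℝ) (S : Finset (Fin n)) :
    ∑ i ∈ S, spread t w i
      = triangular #S + (∑ i ∈ S, ∑ j ∈ Sᶜ, (clamp (t * (w i - w j)) + 1)) / 2 := by
  have hanti : ∑ i ∈ S, ∑ j ∈ S, clamp (t * (w i - w j)) = 0 := by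
    have h : ∑ i ∈ S, ∑ j ∈ S, clamp (t * (w i - w j))
        = - ∑ i ∈ S, ∑ j ∈ S, clamp (t * (w i - w j)) := by
      conv_lhs => rw [sum_comm]
      rw [← sum_neg_distrib]
      refine sum_congr rfl fun i _ => ?_
      rw [← sum_neg_distrib]
      refine sum_congr rfl fun j _ => ?_
      rw [← clamp_neg]; congr 1; ring
    linarith
  have hsplit : ∀ i, ∑ j, clamp (t * (w i - w j))
      = ∑ j ∈ S, clamp (t * (w i - w j)) + ∑ j ∈ Sᶜ, clamp (t * (w i - w j)) := fun i =>
    (sum_add_sum_compl S _).symm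
  have hc : (#Sᶜ : ℝ) = n - #S := by
    rw [card_compl, Fintype.card_fin, Nat.cast_sub (by simpa using card_le_univ S)]
  simp only [spread, sum_add_distrib, ← sum_div, hsplit, hanti, sum_const, nsmul_eq_mul, hc,
    triangular]
  ring

lemma spread_mem_permutohedron (t : ℝ) (w : Fin n → ℝ) : spread t w ∈ permutohedron n := by
  refine mem_permutohedron_of_triangular_le (fun S => ?_) ?_
  · rw [sum_spread]
    have : 0 ≤ ∑ i ∈ S, ∑ j ∈ Sᶜ, (clamp (t * (w i - w j)) + 1) :=
      sum_nonneg fun i _ => sum_nonneg fun j _ => by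
        linarith [neg_one_le_clamp (t * (w i - w j))]
    linarith
  · rw [sum_spread]; simp

lemma isTight_spread_iff (t : ℝ) (w : Fin n → ℝ) (S : Finset (Fin n)) :
    IsTight (spread t w) S ↔ ∀ i ∈ S, ∀ j ∉ S, 1 ≤ t * (w j - w i) := by
  have h0 : ∀ i j, 0 ≤ clamp (t * (w i - w j)) + 1 := fun i j => by
    linarith [neg_one_le_clamp (t * (w i - w j))]
  have hS : IsTight (spread t w) S ↔ ∑ i ∈ S, ∑ j ∈ Sᶜ, (clamp (t * (w i - w j)) + 1) = 0 := by
    rw [IsTight, sum_spread]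
    constructor <;> intro h <;> linarith
  rw [hS, sum_eq_zero_iff_of_nonneg fun i _ => sum_nonneg fun j _ => h0 i j]
  refine forall₂_congr fun i _ => ?_
  rw [sum_eq_zero_iff_of_nonneg fun j _ => h0 i j]
  refine forall_congr' fun j => ?_
  rw [mem_compl, add_eq_zero_iff_eq_neg, clamp_eq_neg_one_iff]
  refine imp_congr_right fun _ => ?_
  constructor <;> intro h <;> linarith

/-- Truncation is only weakly monotone; strictness comes from the summand `k = i`, where `clamp 0`
meets a positive value. -/
lemma spread_lt_spread {t : ℝ} (ht : 0 < t) {w : Fin n → ℝ} {i j : Fin n} (h : w i < w j) :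
    spread t w i < spread t w j := by
  unfold spread
  have : ∑ k, clamp (t * (w i - w k)) < ∑ k, clamp (t * (w j - w k)) := by
    refine sum_lt_sum (fun k _ => clamp_mono (by gcongr)) ⟨i, mem_univ _, ?_⟩
    rw [sub_self, mul_zero, clamp_zero]
    exact clamp_pos (mul_pos ht (sub_pos.2 h))
  linarith

/-- No tight set at `x` separates two elements of `T`. -/
def Unseparated (x : Fin n → ℝ) (T : Finset (Fin n)) : Prop :=
  ∀ S, IsTight x S → ∀ i ∈ T, ∀ j ∈ T, i ∈ S → j ∈ S

/-- Pigeonhole: if some interval `(l, l + 1)` with `l < n` contains no scaled difference from `w i`,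
cutting there gives a tight set separating `i` from a `j` at scaled distance at least `n`. Otherwise
the `n` disjoint intervals use up all `n` indices, including `i`, whose difference is `0`. -/
lemma sub_lt_of_unseparated_spread {t : ℝ} {w : Fin n → ℝ} {i j : Fin n}
    (h : ∀ S, IsTight (spread t w) S → i ∈ S → j ∈ S) : t * (w j - w i) < n := by
  by_contra! hn
  have hex : ∀ l : Fin n, ∃ k, (l : ℝ) < t * (w k - w i) ∧ t * (w k - w i) < l + 1 := by
    by_contra! hl
    obtain ⟨l, hl⟩ := hl
    have hj := h ({k | t * (w k - w i) ≤ l} : Finset (Fin n)) ((isTight_spread_iff _ _ _).2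
      fun k hk k' hk' => by
        simp only [mem_filter, mem_univ, true_and, not_le] at hk hk'
        have := hl k' hk'
        linarith) (by simp)
    simp only [mem_filter, mem_univ, true_and] at hj
    have : ((l : ℕ) : ℝ) < n := by exact_mod_cast l.2
    linarith
  choose k hk using hex
  have hinj : Function.Injective k := by
    intro a b hab
    have h1 := hk a
    have h2 := hk b
    rw [hab] at h1
    have h3 : ((a : ℕ) : ℝ) < (b : ℕ) + 1 := by linarith
    have h4 : ((b : ℕ) : ℝ) < (a : ℕ) + 1 := by linarith
    have h5 : (a : ℕ) < (b : ℕ) + 1 := by exact_mod_cast h3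
    have h6 : (b : ℕ) < (a : ℕ) + 1 := by exact_mod_cast h4
    exact Fin.ext (by omega)
  obtain ⟨l, hl⟩ := Finite.surjective_of_injective hinj i
  have := (hk l).1
  rw [hl, sub_self, mul_zero] at this
  linarith [Nat.cast_nonneg (α := ℝ) (l : ℕ)]

lemma Unseparated.mul_abs_sub_le {t : ℝ} {w : Fin n → ℝ} {T : Finset (Fin n)}
    (h : Unseparated (spread t w) T) {i j : Fin n} (hi : i ∈ T) (hj : j ∈ T) :
    t * |w i - w j| ≤ n := by
  rcases abs_cases (w i - w j) with ⟨h1, _⟩ | ⟨h1, _⟩ <;> rw [h1]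
  · exact (sub_lt_of_unseparated_spread (fun S hS => h S hS j hj i hi)).le
  · rw [neg_sub]
    exact (sub_lt_of_unseparated_spread (fun S hS => h S hS i hi j hj)).le

end Permutohedron

/-! ### Faces, their relative interiors and chains of tight sets -/

namespace OrderedPartition

variable {n : ℕ} (U : OrderedPartition n)

/-- The index of the part containing `i`. -/
noncomputable def idx (i : Fin n) : Fin U.length := (U.cover i).choose

lemma mem_part_idx (i : Fin n) : i ∈ U.part (U.idx i) := (U.cover i).choose_spec

lemma mem_part_iff {i : Fin n} {j : Fin U.length} : i ∈ U.part j ↔ U.idx i = j := by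
  refine ⟨fun h => ?_, fun h => h ▸ U.mem_part_idx i⟩
  by_contra hne
  exact disjoint_left.1 (U.disjoint _ _ hne) (U.mem_part_idx i) h

/-- The union of the parts up to the `k`-th one. -/
noncomputable def initial (k : Fin U.length) : Finset (Fin n) := {i | U.idx i ≤ k}

lemma mem_initial {i : Fin n} {k : Fin U.length} : i ∈ U.initial k ↔ U.idx i ≤ k := by
  simp [initial]

variable {U} in
lemma IsCovector.lt_iff {a : Fin n → ℝ} (h : U.IsCovector a) (i j : Fin n) :
    a i < a j ↔ U.idx j < U.idx i := by
  constructor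
  · intro hij
    by_contra! hle
    rcases hle.lt_or_eq with hlt | heq
    · exact lt_asymm hij (h.2 _ _ hlt i (U.mem_part_idx i) j (U.mem_part_idx j))
    · exact hij.ne (h.1 _ i (U.mem_part_idx i) j (heq ▸ U.mem_part_idx j))
  · intro hlt
    exact h.2 _ _ hlt j (U.mem_part_idx j) i (U.mem_part_idx i)

/-- A point of the face in general position: the vector of part indices, pushed to the
permutohedron. -/
noncomputable def barycenter : Fin n → ℝ := spread 1 fun i => ((U.idx i : ℕ) : ℝ)

lemma barycenter_mem : U.barycenter ∈ permutohedron n := spread_mem_permutohedron _ _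

lemma isTight_barycenter_iff (S : Finset (Fin n)) :
    IsTight U.barycenter S ↔ ∀ i ∈ S, ∀ j ∉ S, U.idx i < U.idx j := by
  rw [barycenter, isTight_spread_iff]
  refine forall₂_congr fun i _ => forall₂_congr fun j _ => ?_
  rw [one_mul, le_sub_iff_add_le, add_comm, ← Nat.cast_add_one, Nat.cast_le, Nat.succ_le_iff,
    Fin.lt_def]

lemma isTight_barycenter_initial (k : Fin U.length) : IsTight U.barycenter (U.initial k) :=
  (U.isTight_barycenter_iff _).2 fun i hi j hj => by
    rw [mem_initial] at hi hj
    exact hi.trans_lt (not_le.1 hj)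

lemma mem_face_iff {x : Fin n → ℝ} :
    x ∈ U.face ↔ x ∈ permutohedron n ∧ ∀ k, IsTight x (U.initial k) := by
  constructor
  · rintro ⟨hx, hmin⟩
    refine ⟨hx, ?_⟩
    -- This covector is the sum of the indicators of the initial unions. Its minimum is therefore
    -- attained only where all their inequalities are equalities, as they are at the barycenter.
    set a : Fin n → ℝ := fun i => (#(Ici (U.idx i)) : ℝ) with ha
    have hcov : U.IsCovector a := by
      constructor
      · intro j i hi i' hi'
        rw [mem_part_iff] at hi hi'
        simp [ha, hi, hi']
      · intro j k hjk i hi i' hi'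
        rw [mem_part_iff] at hi hi'
        simp only [ha, hi, hi', Nat.cast_lt]
        exact card_lt_card (Ici_ssubset_Ici.2 hjk)
    have hsum : ∀ y : Fin n → ℝ, ∑ i, a i * y i = ∑ k, ∑ i ∈ U.initial k, y i := fun y => by
      simp only [initial, sum_filter]
      rw [sum_comm]
      refine sum_congr rfl fun i _ => ?_
      rw [← sum_filter, sum_const, nsmul_eq_mul]
      have : ({k | U.idx i ≤ k} : Finset (Fin U.length)) = Ici (U.idx i) := by ext k; simp
      rw [this]
    have h := hmin a hcov _ U.barycenter_mem
    rw [hsum, hsum, sum_congr rfl fun k _ => U.isTight_barycenter_initial k] at h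
    have hle : ∀ k ∈ univ, triangular #(U.initial k) ≤ ∑ i ∈ U.initial k, x i :=
      fun k _ => triangular_le_sum hx _
    have := (sum_eq_sum_iff_of_le hle).1 (le_antisymm (sum_le_sum hle) h)
    exact fun k => (this k (mem_univ k)).symm
  · rintro ⟨hx, ht⟩
    refine ⟨hx, fun a ha y hy => sum_mul_le_sum_mul_of_superlevel a x y
      ((isTight_univ hx).trans (isTight_univ hy).symm) fun c => ?_⟩
    rcases ({i | c < a i} : Finset (Fin n)).eq_empty_or_nonempty with h | h
    · rw [h]; simp
    obtain ⟨i₀, hi₀, hmax⟩ := exists_max_image _ U.idx h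
    simp only [mem_filter, mem_univ, true_and] at hi₀ hmax
    have hS : ({i | c < a i} : Finset (Fin n)) = U.initial (U.idx i₀) := by
      ext i
      simp only [mem_filter, mem_univ, true_and, mem_initial]
      refine ⟨hmax i, fun hi => hi₀.trans_le ?_⟩
      by_contra! hlt
      exact (((ha.lt_iff _ _).1 hlt).trans_le hi).false
    rw [hS, ht]
    exact triangular_le_sum hy _

lemma idx_eq_of_forall_isTight_initial {x : Fin n → ℝ} (hx : ∀ k, IsTight x (U.initial k))
    {T : Finset (Fin n)} (hT : Unseparated x T) {i j : Fin n} (hi : i ∈ T) (hj : j ∈ T) :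
    U.idx i = U.idx j := by
  refine le_antisymm ?_ ?_
  · exact U.mem_initial.1 (hT _ (hx (U.idx j)) j hj i hi (U.mem_initial.2 le_rfl))
  · exact U.mem_initial.1 (hT _ (hx (U.idx i)) i hi j hj (U.mem_initial.2 le_rfl))

/-- The segment from `y` to `x` extends slightly beyond `x` inside the face; a positive excess of
`y` on `S` would make the extension violate the inequality of `S`. -/
lemma isTight_of_mem_intrinsicInterior_face {x y : Fin n → ℝ}
    (hx : x ∈ intrinsicInterior ℝ U.face) (hy : y ∈ U.face) {S : Finset (Fin n)}
    (hS : IsTight x S) : IsTight y S := by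
  obtain ⟨z, hz, rfl⟩ := mem_intrinsicInterior.1 hx
  have hyA : y ∈ affineSpan ℝ U.face := subset_affineSpan ℝ _ hy
  set c : ℝ → affineSpan ℝ U.face :=
    fun t => ⟨AffineMap.lineMap (z : Fin n → ℝ) y t, AffineMap.lineMap_mem t z.2 hyA⟩ with hc
  have hcont : Continuous c := Continuous.subtype_mk AffineMap.lineMap_continuous _
  have h0 : c 0 = z := Subtype.ext (AffineMap.lineMap_apply_zero _ _)
  have hnhds : ∀ᶠ t in nhds (0 : ℝ), (c t : Fin n → ℝ) ∈ U.face := by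
    have : interior ((↑) ⁻¹' U.face : Set (affineSpan ℝ U.face)) ∈ nhds (c 0) := by
      rw [h0]; exact isOpen_interior.mem_nhds hz
    filter_upwards [hcont.continuousAt this] with t ht
    exact interior_subset (s := ((↑) ⁻¹' U.face : Set (affineSpan ℝ U.face))) ht
  obtain ⟨ε, hε, hball⟩ := Metric.eventually_nhds_iff.1 hnhds
  have hmem : (c (-(ε / 2)) : Fin n → ℝ) ∈ U.face := by
    apply hball
    rw [dist_zero_right, norm_neg, Real.norm_of_nonneg (by positivity)]
    linarith
  have h1 := triangular_le_sum hmem.1 S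
  have h2 : ∑ i ∈ S, (c (-(ε / 2)) : Fin n → ℝ) i
      = ∑ i ∈ S, (z : Fin n → ℝ) i
        - ε / 2 * (∑ i ∈ S, y i - ∑ i ∈ S, (z : Fin n → ℝ) i) := by
    rw [← sum_sub_distrib, mul_sum, ← sum_sub_distrib]
    refine sum_congr rfl fun i _ => ?_
    simp only [hc, AffineMap.lineMap_apply_module', Pi.add_apply, Pi.smul_apply, Pi.sub_apply,
      smul_eq_mul]
    ring
  rw [h2, hS] at h1
  refine le_antisymm ?_ (triangular_le_sum hy.1 S)
  by_contra! hlt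
  have := mul_pos (half_pos hε) (sub_pos.2 hlt)
  linarith

lemma unseparated_part_of_mem_intrinsicInterior {x : Fin n → ℝ}
    (hx : x ∈ intrinsicInterior ℝ U.face) {T : Finset (Fin n)} {k : Fin U.length}
    (hT : T ⊆ U.part k) : Unseparated x T := by
  intro S hS i hi j hj hiS
  by_contra hjS
  have h := (U.isTight_barycenter_iff S).1 (U.isTight_of_mem_intrinsicInterior_face hx
    (U.mem_face_iff.2 ⟨U.barycenter_mem, U.isTight_barycenter_initial⟩) hS) i hiS j hjS
  rw [U.mem_part_iff.1 (hT hi), U.mem_part_iff.1 (hT hj)] at h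
  exact h.false

/-- Equalities at `x` persist on the affine span of the face, and the finitely many inequalities
strict at `x` define an open neighbourhood there. -/
lemma mem_intrinsicInterior_face {x : Fin n → ℝ} (hx : x ∈ permutohedron n)
    (hinit : ∀ k, IsTight x (U.initial k))
    (htight : ∀ S, IsTight x S → S = ∅ ∨ ∃ k, S = U.initial k) :
    x ∈ intrinsicInterior ℝ U.face := by
  have hspan : ∀ S, IsTight x S → ∀ y ∈ affineSpan ℝ U.face, IsTight y S := by
    intro S hS y hy
    refine affineSpan_induction (p := fun y => IsTight y S) hy (fun y hy => ?_)
      fun c u v w hu hv hw => ?_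
    · rcases htight S hS with rfl | ⟨k, rfl⟩
      · exact isTight_empty y
      · exact (U.mem_face_iff.1 hy).2 k
    · unfold IsTight at hu hv hw ⊢
      have : ∑ i ∈ S, (c • (u -ᵥ v) +ᵥ w) i
          = c * (∑ i ∈ S, u i - ∑ i ∈ S, v i) + ∑ i ∈ S, w i := by
        rw [← sum_sub_distrib, mul_sum, ← sum_add_distrib]
        exact sum_congr rfl fun i _ => rfl
      rw [this, hu, hv, hw]; ring
  have hxA : x ∈ affineSpan ℝ U.face :=
    subset_affineSpan ℝ _ (U.mem_face_iff.2 ⟨hx, hinit⟩)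
  refine mem_intrinsicInterior.2 ⟨⟨x, hxA⟩, mem_interior.2
    ⟨⋂ S : {S : Finset (Fin n) // ¬ IsTight x S},
      {y | triangular #S.1 < ∑ i ∈ S.1, (y : Fin n → ℝ) i}, ?_, ?_, ?_⟩, rfl⟩
  · intro y hy
    rw [Set.mem_iInter] at hy
    have hyS : ∀ S : Finset (Fin n), triangular #S ≤ ∑ i ∈ S, (y : Fin n → ℝ) i := fun S => by
      by_cases hS : IsTight x S
      · exact (hspan S hS y y.2).ge
      · exact (hy ⟨S, hS⟩).le
    refine U.mem_face_iff.2 ⟨mem_permutohedron_of_triangular_le hyS ?_,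
      fun k => hspan _ (hinit k) y y.2⟩
    simpa [IsTight] using hspan _ (isTight_univ hx) y y.2
  · refine isOpen_iInter_of_finite fun S => isOpen_lt continuous_const ?_
    exact continuous_finsetSum _ fun i _ => (continuous_apply i).comp continuous_subtype_val
  · rw [Set.mem_iInter]
    exact fun S => lt_of_le_of_ne (triangular_le_sum hx _) (Ne.symm S.2)

/-- The ordered partition into the level sets of a function, by increasing value. -/
noncomputable def ofFun (ρ : Fin n → ℕ) : OrderedPartition n where
  length := #(univ.image ρ)
  part k := {i | ρ i = (univ.image ρ).orderEmbOfFin rfl k}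
  nonempty k := by
    obtain ⟨i, -, hi⟩ := mem_image.1 ((univ.image ρ).orderEmbOfFin_mem rfl k)
    exact ⟨i, by simpa using hi⟩
  disjoint j k hjk := by
    refine disjoint_left.2 fun i hi hi' => hjk ?_
    simp only [mem_filter, mem_univ, true_and] at hi hi'
    exact ((univ.image ρ).orderEmbOfFin rfl).injective (hi.symm.trans hi')
  cover i := by
    have : ρ i ∈ Set.range ((univ.image ρ).orderEmbOfFin rfl) := by
      rw [range_orderEmbOfFin]; simp
    obtain ⟨k, hk⟩ := this
    exact ⟨k, by simpa using hk.symm⟩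

lemma idx_ofFun_le_iff (ρ : Fin n → ℕ) (i j : Fin n) :
    (ofFun ρ).idx i ≤ (ofFun ρ).idx j ↔ ρ i ≤ ρ j := by
  have h : ∀ i, ρ i = (univ.image ρ).orderEmbOfFin rfl ((ofFun ρ).idx i) := fun i =>
    (mem_filter.1 ((ofFun ρ).mem_part_idx i)).2
  rw [h i, h j]
  exact ((univ.image ρ).orderEmbOfFin rfl).le_iff_le.symm

/-- The tight sets at a point of the permutohedron are the initial unions of an ordered
partition. -/
lemma exists_isTight_initial {x : Fin n → ℝ} (hx : x ∈ permutohedron n) :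
    ∃ U : OrderedPartition n, (∀ k, IsTight x (U.initial k)) ∧
      ∀ S, IsTight x S → S = ∅ ∨ ∃ k, S = U.initial k := by
  classical
  -- Since the tight sets form a chain, counting those that miss `i` ranks the indices so that every
  -- tight set is a lower set.
  set ρ : Fin n → ℕ := fun i => #{S : Finset (Fin n) | IsTight x S ∧ i ∉ S} with hρ
  have hlow : ∀ S, IsTight x S → ∀ i ∈ S, ∀ j, ρ j ≤ ρ i → j ∈ S := by
    intro S hS i hi j hji
    by_contra hj
    refine hji.not_gt (card_lt_card ((ssubset_iff_of_subset ?_).2 ⟨S, ?_, ?_⟩))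
    · intro T hT
      simp only [mem_filter, mem_univ, true_and] at hT ⊢
      refine ⟨hT.1, fun hjT => ?_⟩
      rcases hS.subset_or_subset hx hT.1 with h | h
      · exact hT.2 (h hi)
      · exact hj (h hjT)
    · simp [hS, hj]
    · simp [hi]
  refine ⟨ofFun ρ, fun k => ?_, fun S hS => ?_⟩
  · obtain ⟨i₀, hi₀⟩ := (ofFun ρ).nonempty k
    rw [← (ofFun ρ).mem_part_iff.1 hi₀]
    -- The smallest tight set containing `i₀` is the initial union ending at the part of `i₀`.
    obtain ⟨S, hS, hmin⟩ := exists_min_image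
      ({S | IsTight x S ∧ i₀ ∈ S} : Finset (Finset (Fin n))) card ⟨univ, by simp [isTight_univ hx]⟩
    simp only [mem_filter, mem_univ, true_and] at hS hmin
    have hSeq : (ofFun ρ).initial ((ofFun ρ).idx i₀) = S := by
      ext j
      rw [mem_initial, idx_ofFun_le_iff]
      refine ⟨hlow S hS.1 i₀ hS.2 j, fun hj => card_le_card fun T hT => ?_⟩
      simp only [mem_filter, mem_univ, true_and] at hT ⊢
      refine ⟨hT.1, fun hiT => hT.2 ?_⟩
      rcases hS.1.subset_or_subset hx hT.1 with h | h
      · exact h hj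
      · exact (eq_of_subset_of_card_le h (hmin T ⟨hT.1, hiT⟩)).symm ▸ hj
    rw [hSeq]
    exact hS.1
  · refine S.eq_empty_or_nonempty.imp id fun h => ?_
    obtain ⟨i₀, hi₀, hmax⟩ := exists_max_image S ρ h
    refine ⟨(ofFun ρ).idx i₀, ?_⟩
    ext j
    rw [mem_initial, idx_ofFun_le_iff]
    exact ⟨hmax j, hlow S hS i₀ hi₀ j⟩

end OrderedPartition

/-! ### Removed faces in terms of tight sets -/

section Complex

variable {m : ℕ} (K : AbstractSimplicialComplex (Fin m))

lemma nonempty_of_not_isSimplex {I : Finset (Fin m)} (hI : ¬ IsSimplex K I) : I.Nonempty :=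
  nonempty_iff_ne_empty.2 fun h => hI (Or.inl h)

/-- The index set `I` and its primed copy are both unseparated at `x`. -/
def UnseparatedPair (x : Fin (m + m) → ℝ) (I : Finset (Fin m)) : Prop :=
  Unseparated x (I.map (Fin.castAddEmb m)) ∧ Unseparated x (I.map (Fin.natAddEmb m))

lemma OrderedPartition.absorbs_iff (U : OrderedPartition (m + m)) (I : Finset (Fin m)) :
    U.Absorbs I ↔ ∃ j k, I.map (Fin.castAddEmb m) ⊆ U.part j ∧
      I.map (Fin.natAddEmb m) ⊆ U.part k := by
  simp [OrderedPartition.Absorbs, subset_iff]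

lemma OrderedPartition.absorbs_of_unseparatedPair {U : OrderedPartition (m + m)}
    {x : Fin (m + m) → ℝ} (hx : ∀ k, IsTight x (U.initial k)) {I : Finset (Fin m)}
    (hI : I.Nonempty) (h : UnseparatedPair x I) : U.Absorbs I := by
  obtain ⟨i, hi⟩ := hI
  refine (U.absorbs_iff I).2 ⟨U.idx (Fin.castAddEmb m i), U.idx (Fin.natAddEmb m i),
    fun j hj => ?_, fun j hj => ?_⟩
  · exact U.mem_part_iff.2 (U.idx_eq_of_forall_isTight_initial hx h.1 hj (mem_map_of_mem _ hi))
  · exact U.mem_part_iff.2 (U.idx_eq_of_forall_isTight_initial hx h.2 hj (mem_map_of_mem _ hi))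

lemma unseparatedPair_of_absorbs {U : OrderedPartition (m + m)} {x : Fin (m + m) → ℝ}
    (hx : x ∈ intrinsicInterior ℝ U.face) {I : Finset (Fin m)} (h : U.Absorbs I) :
    UnseparatedPair x I := by
  obtain ⟨j, k, hj, hk⟩ := (U.absorbs_iff I).1 h
  exact ⟨U.unseparated_part_of_mem_intrinsicInterior hx hj,
    U.unseparated_part_of_mem_intrinsicInterior hx hk⟩

/-- The partition built from the tight sets at `x` has `x` in the relative interior of its face, so
removal can be tested on the tight sets at `x` alone. -/
lemma mem_complexPermutohedralComplex_iff {x : Fin (m + m) → ℝ} :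
    x ∈ complexPermutohedralComplex K ↔
      x ∈ permutohedron (m + m) ∧ ∀ I, ¬ IsSimplex K I → ¬ UnseparatedPair x I := by
  simp only [complexPermutohedralComplex, Set.mem_sdiff, Set.mem_iUnion, not_exists]
  refine and_congr_right fun hx => forall₂_congr fun I hI => ⟨fun h hsep => ?_, fun h U hU hx' =>
    h (unseparatedPair_of_absorbs hx' hU)⟩
  obtain ⟨U, hU, hU'⟩ := OrderedPartition.exists_isTight_initial hx
  exact h U (OrderedPartition.absorbs_of_unseparatedPair hU (nonempty_of_not_isSimplex K hI) hsep)
    (U.mem_intrinsicInterior_face hx hU hU')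

lemma complexPermutohedralComplex_eq_iUnion_face :
    complexPermutohedralComplex K =
      ⋃ (U : OrderedPartition (m + m)) (_ : ∀ I, ¬ IsSimplex K I → ¬ U.Absorbs I), U.face := by
  ext x
  rw [mem_complexPermutohedralComplex_iff]
  simp only [Set.mem_iUnion, exists_prop]
  constructor
  · rintro ⟨hx, h⟩
    obtain ⟨U, hU, hU'⟩ := OrderedPartition.exists_isTight_initial hx
    exact ⟨U, fun I hI hab => h I hI (unseparatedPair_of_absorbs
      (U.mem_intrinsicInterior_face hx hU hU') hab), U.mem_face_iff.2 ⟨hx, hU⟩⟩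
  · rintro ⟨U, hU, hx⟩
    exact ⟨hx.1, fun I hI h => hU I hI (OrderedPartition.absorbs_of_unseparatedPair
      (U.mem_face_iff.1 hx).2 (nonempty_of_not_isSimplex K hI) h)⟩

lemma mem_complexDiagonalComplement_iff {z : Fin m → ℂ} :
    z ∈ complexDiagonalComplement K ↔
      ∀ I, ¬ IsSimplex K I → ¬ ∀ i ∈ I, ∀ j ∈ I, z i = z j := by
  simp only [complexDiagonalComplement, Set.mem_sdiff, Set.mem_univ, true_and, Set.mem_iUnion,
    not_exists]
  rfl

/-! ### The two maps and the dilation factor -/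

/-- The real and the imaginary parts of the coordinates, in this order. -/
def reIm (z : Fin m → ℂ) : Fin (m + m) → ℝ := Fin.append (fun i => (z i).re) fun i => (z i).im

/-- The complex vector with given real and imaginary parts. -/
def ofReIm (x : Fin (m + m) → ℝ) : Fin m → ℂ := fun i => ⟨x (Fin.castAdd m i), x (Fin.natAdd m i)⟩

lemma reIm_castAdd (z : Fin m → ℂ) (i : Fin m) : reIm z (Fin.castAdd m i) = (z i).re :=
  Fin.append_left _ _ i

lemma reIm_natAdd (z : Fin m → ℂ) (i : Fin m) : reIm z (Fin.natAdd m i) = (z i).im :=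
  Fin.append_right _ _ i

lemma continuous_reIm : Continuous (reIm (m := m)) := by
  refine continuous_pi fun k => ?_
  refine Fin.addCases (fun i => ?_) (fun i => ?_) k
  · simp only [reIm_castAdd]
    exact Complex.continuous_re.comp (continuous_apply i)
  · simp only [reIm_natAdd]
    exact Complex.continuous_im.comp (continuous_apply i)

lemma continuous_ofReIm : Continuous (ofReIm (m := m)) :=
  continuous_pi fun i => by
    have := Complex.equivRealProdCLM.symm.continuous.comp
      ((continuous_apply (A := fun _ : Fin (m + m) => ℝ) (Fin.castAdd m i)).prodMk
        (continuous_apply (Fin.natAdd m i)))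
    convert this using 1
    funext x
    refine Complex.ext ?_ ?_ <;> simp [ofReIm, Complex.equivRealProdCLM_symm_apply]

lemma reIm_ofReIm (x : Fin (m + m) → ℝ) : reIm (ofReIm x) = x := by
  funext k
  refine Fin.addCases (fun i => ?_) (fun i => ?_) k
  · rw [reIm_castAdd]; rfl
  · rw [reIm_natAdd]; rfl

/-- The spread of the coordinates of `z` with indices in `I`, which vanishes exactly on the
diagonal of `I`. -/
noncomputable def diagonalGap (I : Finset (Fin m)) (z : Fin m → ℂ) : ℝ :=
  ∑ i ∈ I, ∑ j ∈ I, (|(z i).re - (z j).re| + |(z i).im - (z j).im|)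

lemma continuous_diagonalGap (I : Finset (Fin m)) : Continuous (diagonalGap I) := by
  unfold diagonalGap
  fun_prop

lemma diagonalGap_nonneg (I : Finset (Fin m)) (z : Fin m → ℂ) : 0 ≤ diagonalGap I z :=
  sum_nonneg fun _ _ => sum_nonneg fun _ _ => by positivity

lemma diagonalGap_pos {z : Fin m → ℂ} (hz : z ∈ complexDiagonalComplement K)
    {I : Finset (Fin m)} (hI : ¬ IsSimplex K I) : 0 < diagonalGap I z := by
  refine lt_of_le_of_ne (diagonalGap_nonneg I z) fun h => ?_
  refine (mem_complexDiagonalComplement_iff K).1 hz I hI fun i hi j hj => ?_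
  have h1 := (sum_eq_zero_iff_of_nonneg fun _ _ => sum_nonneg fun _ _ => by positivity).1 h.symm
    i hi
  have h2 := (sum_eq_zero_iff_of_nonneg fun _ _ => by positivity).1 h1 j hj
  have h3 := abs_nonneg ((z i).re - (z j).re)
  have h4 := abs_nonneg ((z i).im - (z j).im)
  exact Complex.ext (sub_eq_zero.1 (abs_eq_zero.1 (by linarith)))
    (sub_eq_zero.1 (abs_eq_zero.1 (by linarith)))

/-- The product of the dilation factor and the gap of `I` has to exceed this bound. -/
noncomputable def gapBound (I : Finset (Fin m)) : ℝ :=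
  ∑ _i ∈ I, ∑ _j ∈ I, (((m + m : ℕ) : ℝ) + ((m + m : ℕ) : ℝ))

lemma gapBound_nonneg (I : Finset (Fin m)) : 0 ≤ gapBound I :=
  sum_nonneg fun _ _ => sum_nonneg fun _ _ => by positivity

open Classical in
/-- A dilation factor under which the gaps of all nonsimplices become large. -/
noncomputable def dilation (z : Fin m → ℂ) : ℝ :=
  1 + ∑ I with ¬ IsSimplex K I, gapBound I / diagonalGap I z

/-- The homotopy on the diagonal complement needs only positivity; the one on the permutohedral
complex needs the bound `1` to keep tight sets tight. -/
lemma one_le_dilation (z : Fin m → ℂ) : 1 ≤ dilation K z :=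
  le_add_of_nonneg_right (sum_nonneg fun I _ =>
    div_nonneg (gapBound_nonneg I) (diagonalGap_nonneg I z))

lemma gapBound_lt_dilation_mul {z : Fin m → ℂ} (hz : z ∈ complexDiagonalComplement K)
    {I : Finset (Fin m)} (hI : ¬ IsSimplex K I) :
    gapBound I < dilation K z * diagonalGap I z := by
  classical
  have hpos := diagonalGap_pos K hz hI
  rw [← div_lt_iff₀ hpos]
  have := single_le_sum (f := fun I => gapBound I / diagonalGap I z)
    (s := ({I | ¬ IsSimplex K I} : Finset (Finset (Fin m))))
    (fun I _ => div_nonneg (gapBound_nonneg I) (diagonalGap_nonneg I z)) (by simpa using hI)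
  unfold dilation
  linarith

lemma continuous_dilation :
    Continuous fun z : complexDiagonalComplement K => dilation K (z : Fin m → ℂ) := by
  classical
  unfold dilation
  refine continuous_const.add (continuous_finsetSum _ fun I hI => ?_)
  exact continuous_const.div ((continuous_diagonalGap I).comp continuous_subtype_val)
    fun z => (diagonalGap_pos K z.2 (mem_filter.1 hI).2).ne'

lemma dilation_mul_diagonalGap_le {t : ℝ} {z : Fin m → ℂ} {I : Finset (Fin m)}
    (h : UnseparatedPair (spread t (reIm z)) I) : t * diagonalGap I z ≤ gapBound I := by
  unfold diagonalGap gapBound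
  rw [mul_sum]
  refine sum_le_sum fun i hi => ?_
  rw [mul_sum]
  refine sum_le_sum fun j hj => ?_
  rw [mul_add, ← reIm_castAdd, ← reIm_castAdd, ← reIm_natAdd, ← reIm_natAdd]
  exact add_le_add
    (h.1.mul_abs_sub_le (mem_map_of_mem (Fin.castAddEmb m) hi) (mem_map_of_mem _ hj))
    (h.2.mul_abs_sub_le (mem_map_of_mem (Fin.natAddEmb m) hi) (mem_map_of_mem _ hj))

lemma spread_dilation_mem {z : Fin m → ℂ} (hz : z ∈ complexDiagonalComplement K) :
    spread (dilation K z) (reIm z) ∈ complexPermutohedralComplex K :=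
  (mem_complexPermutohedralComplex_iff K).2 ⟨spread_mem_permutohedron _ _, fun _ hI h =>
    (gapBound_lt_dilation_mul K hz hI).not_ge (dilation_mul_diagonalGap_le h)⟩

lemma unseparated_of_forall_eq {n : ℕ} {x : Fin n → ℝ} (hx : x ∈ permutohedron n)
    {T : Finset (Fin n)} (h : ∀ i ∈ T, ∀ j ∈ T, x i = x j) : Unseparated x T := by
  intro S hS i hi j hj hiS
  by_contra hjS
  linarith [hS.add_one_le hx hiS hjS, h i hi j hj]

lemma ofReIm_mem {x : Fin (m + m) → ℝ} (hx : x ∈ complexPermutohedralComplex K) :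
    ofReIm x ∈ complexDiagonalComplement K := by
  rw [mem_complexPermutohedralComplex_iff] at hx
  refine (mem_complexDiagonalComplement_iff K).2 fun I hI h => hx.2 I hI
    ⟨unseparated_of_forall_eq hx.1 ?_, unseparated_of_forall_eq hx.1 ?_⟩
  · simp only [forall_mem_map]
    exact fun i hi j hj => congrArg Complex.re (h i hi j hj)
  · simp only [forall_mem_map]
    exact fun i hi j hj => congrArg Complex.im (h i hi j hj)

/-! ### Continuity and straight-line homotopies -/

lemma continuous_spread {n : ℕ} {X : Type*} [TopologicalSpace X] {t : X → ℝ}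
    {w : X → Fin n → ℝ} (ht : Continuous t) (hw : Continuous w) :
    Continuous fun x => spread (t x) (w x) := by
  unfold spread
  refine continuous_pi fun i => continuous_const.add (Continuous.div_const ?_ _)
  refine continuous_finsetSum _ fun j _ => continuous_clamp.comp ?_
  fun_prop

/-- Both `spread t w` and `w` order coordinates as `w` does, hence so does any convex combination of
them. -/
lemma eq_of_combo_spread_eq {n : ℕ} {t a b : ℝ} (ht : 0 < t) (ha : 0 ≤ a) (hb : 0 ≤ b)
    (hab : a + b = 1) {w : Fin n → ℝ} {i j : Fin n}
    (h : a * spread t w i + b * w i = a * spread t w j + b * w j) : w i = w j := by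
  have key : ∀ i j, w i < w j → a * spread t w i + b * w i < a * spread t w j + b * w j := by
    intro i j hij
    have hs := spread_lt_spread ht hij
    rcases ha.eq_or_lt with rfl | ha'
    · have : b = 1 := by linarith
      subst this; linarith
    · exact add_lt_add_of_lt_of_le (mul_lt_mul_of_pos_left hs ha')
        (mul_le_mul_of_nonneg_left hij.le hb)
  rcases lt_trichotomy (w i) (w j) with hlt | heq | hlt
  · exact absurd h (key i j hlt).ne
  · exact heq
  · exact absurd h (key j i hlt).ne'

lemma combo_ofReIm_spread_mem {z : Fin m → ℂ} (hz : z ∈ complexDiagonalComplement K)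
    {t a b : ℝ} (ht : 0 < t) (ha : 0 ≤ a) (hb : 0 ≤ b) (hab : a + b = 1) :
    a • ofReIm (spread t (reIm z)) + b • z ∈ complexDiagonalComplement K := by
  rw [mem_complexDiagonalComplement_iff] at hz ⊢
  refine fun I hI h => hz I hI fun i hi j hj => ?_
  have hij := h i hi j hj
  refine Complex.ext ?_ ?_
  · rw [← reIm_castAdd, ← reIm_castAdd]
    refine eq_of_combo_spread_eq ht ha hb hab ?_
    simpa only [ofReIm, Pi.add_apply, Pi.smul_apply, Complex.add_re, Complex.smul_re,
      smul_eq_mul, reIm_castAdd] using congrArg Complex.re hij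
  · rw [← reIm_natAdd, ← reIm_natAdd]
    refine eq_of_combo_spread_eq ht ha hb hab ?_
    simpa only [ofReIm, Pi.add_apply, Pi.smul_apply, Complex.add_im, Complex.smul_im,
      smul_eq_mul, reIm_natAdd] using congrArg Complex.im hij

/-- The gap of one across a tight set remains at least one after scaling by `t ≥ 1`, so all
differences across it are fully truncated. -/
lemma IsTight.spread_self {n : ℕ} {x : Fin n → ℝ} (hx : x ∈ permutohedron n) {t : ℝ} (ht : 1 ≤ t)
    {S : Finset (Fin n)} (hS : IsTight x S) : IsTight (spread t x) S :=
  (isTight_spread_iff _ _ _).2 fun i hi j hj => by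
    have := hS.add_one_le hx hi hj
    nlinarith

/-- Every set tight at `x` stays tight along the segment, so whatever was separated at `x` remains
separated. -/
lemma combo_spread_self_mem {x : Fin (m + m) → ℝ} (hx : x ∈ complexPermutohedralComplex K)
    {t a b : ℝ} (ht : 1 ≤ t) (ha : 0 ≤ a) (hb : 0 ≤ b) (hab : a + b = 1) :
    a • spread t x + b • x ∈ complexPermutohedralComplex K := by
  rw [mem_complexPermutohedralComplex_iff] at hx ⊢
  refine ⟨convex_permutohedron (spread_mem_permutohedron t x) hx.1 ha hb hab, fun I hI h =>
    hx.2 I hI ⟨fun S hS => ?_, fun S hS => ?_⟩⟩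
  · exact h.1 S ((hS.spread_self hx.1 ht).combo hS hab)
  · exact h.2 S ((hS.spread_self hx.1 ht).combo hS hab)

/-- Two maps into a subset of a real topological vector space are homotopic if the segments
between their values stay in the subset. -/
lemma homotopic_of_segment_subset {X E : Type*} [TopologicalSpace X] [TopologicalSpace E]
    [AddCommGroup E] [Module ℝ E] [ContinuousAdd E] [ContinuousSMul ℝ E] {s : Set E}
    (f g : C(X, s))
    (h : ∀ x, ∀ a b : ℝ, 0 ≤ a → 0 ≤ b → a + b = 1 → a • (f x : E) + b • (g x : E) ∈ s) :
    f.Homotopic g :=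
  ⟨{ toFun := fun p => ⟨(1 - (p.1 : ℝ)) • (f p.2 : E) + (p.1 : ℝ) • (g p.2 : E),
        h p.2 _ _ (sub_nonneg.2 p.1.2.2) p.1.2.1 (sub_add_cancel _ _)⟩
     continuous_toFun := by fun_prop
     map_zero_left := fun x => Subtype.ext (by simp)
     map_one_left := fun x => Subtype.ext (by simp) }⟩

/-- The complement of the complex diagonal arrangement and the complex permutohedral complex are
homotopy equivalent. -/
noncomputable def diagonalComplementHomotopyEquiv :
    complexDiagonalComplement K ≃ₕ complexPermutohedralComplex K where
  toFun := ⟨fun z => ⟨_, spread_dilation_mem K z.2⟩,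
    (continuous_spread (continuous_dilation K)
      (continuous_reIm.comp continuous_subtype_val)).subtype_mk _⟩
  invFun := ⟨fun x => ⟨_, ofReIm_mem K x.2⟩,
    (continuous_ofReIm.comp continuous_subtype_val).subtype_mk _⟩
  left_inv := homotopic_of_segment_subset _ _ fun z _ _ ha hb hab =>
    combo_ofReIm_spread_mem K z.2 (one_pos.trans_le (one_le_dilation K z)) ha hb hab
  right_inv := homotopic_of_segment_subset _ _ fun x a b ha hb hab => by
    have := combo_spread_self_mem K x.2 (one_le_dilation K (ofReIm x)) ha hb hab
    simpa [reIm_ofReIm] using this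

end Complex

theorem mainTheorem6 (m : ℕ) (K : AbstractSimplicialComplex (Fin m)) :
    (complexPermutohedralComplex K =
        ⋃ (U : OrderedPartition (m + m)) (_ : ∀ I, ¬ IsSimplex K I → ¬ U.Absorbs I), U.face) ∧
      Nonempty (complexDiagonalComplement K ≃ₕ complexPermutohedralComplex K) :=
  ⟨complexPermutohedralComplex_eq_iUnion_face K, ⟨diagonalComplementHomotopyEquiv K⟩⟩
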